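/- Let $p$ be a prime. Call a real number $c>0$ a Meshulam constant for $p$ if for every $n\ge 1$, every set $S\subseteq\mathbb F_p^n$ with $|S|\ge c\,p^n/n$ contains a non-trivial three-term arithmetic progression $m,\,m+d,\,m+2d$ (non-trivial meaning $d\ne 0$). For $f:\mathbb F_{p^n}\to[0,1]$ put $$\mathbb E(f)=p^{-n}\sum_m f(m),\qquad \Lambda_3(f)=p^{-2n}\sum_{m,d}f(m)f(m+d)f(m+2d),$$ and, for an $\mathbb F_p$-subspace $W$ of $\mathbb F_{p^n}$, $f_W(m)=|W|^{-1}\sum_{w\in W}f(m+w)$. Here $\mathbb F_{p^n}$ is regarded as an $n$-dimensional vector space over $\mathbb F_p$. Theorem. Meshulam constants for $p$ exist. Let $c_p$ be any Meshulam constant for $p$, let $\epsilon>0$, and put $$\Delta=\frac{\epsilon^6}{2^{13}p^2}\,\exp\!\left(-16\,\epsilon^{-1}c_p\log p\right).$$ Let $n$ be arbitrary and suppose that $f:\mathbb F_{p^n}\to[0,1]$ satisfies $$\mathbb E\bigl(|f(m)-f_W(m)|\bigr)>\epsilon$$ for every subspace $W$ of $\mathbb F_{p^n}$ of codimension at most $\Delta^{-2}$.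 Then there is a function $g:\mathbb F_{p^n}\to[0,1]$ such that $$\mathbb E(g)=\mathbb E(f)\qquad\text{and}\qquad \Lambda_3(g)<\Lambda_3(f)-\Delta .$$ -/

import Mathlib

namespace ThreeAP

/-- `𝔼(f) = |V|⁻¹ ∑_m f(m)`; when `V` is `n`-dimensional over `𝔽_p`, `|V| = p^n`. -/
noncomputable def mean {V : Type*} [Fintype V] (f : V → ℝ) : ℝ :=
  (Fintype.card V : ℝ)⁻¹ * ∑ m : V, f m

/-- `Λ₃(f) = |V|⁻² ∑_{m,d} f(m) f(m+d) f(m+2d)`. -/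
noncomputable def Lambda3 {V : Type*} [AddCommGroup V] [Fintype V] (f : V → ℝ) : ℝ :=
  ((Fintype.card V : ℝ) ^ 2)⁻¹ * ∑ m : V, ∑ d : V, f m * f (m + d) * f (m + 2 • d)

open Classical in
/-- `f_W(m) = |W|⁻¹ ∑_{w ∈ W} f(m+w)`. -/
noncomputable def cosetMean {K V : Type*} [Field K] [AddCommGroup V] [Module K V] [Fintype V]
    (W : Submodule K V) (f : V → ℝ) (m : V) : ℝ :=
  (Fintype.card W : ℝ)⁻¹ * ∑ w : W, f (m + (w : V))

/-- `c > 0` is an admissible constant in Meshulam's theorem for the prime `p`: for every `n ≥ 1`,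
every `S ⊆ 𝔽_p^n` with `|S| ≥ c p^n / n` contains a progression `m, m+d, m+2d` with `d ≠ 0`. -/
def IsMeshulamConstant (p : ℕ) (c : ℝ) : Prop :=
  0 < c ∧ ∀ n : ℕ, 1 ≤ n → ∀ S : Finset (Fin n → ZMod p),
    c * (p : ℝ) ^ n / (n : ℝ) ≤ (S.card : ℝ) →
      ∃ m d : Fin n → ZMod p, d ≠ 0 ∧ m ∈ S ∧ m + d ∈ S ∧ m + 2 • d ∈ S

/-- `Δ = (ε⁶ / (2¹³ p²)) exp(-16 ε⁻¹ c log p)`. -/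
noncomputable def Delta (p : ℕ) (c ε : ℝ) : ℝ :=
  ε ^ 6 / (2 ^ 13 * (p : ℝ) ^ 2) * Real.exp (-16 * ε⁻¹ * c * Real.log (p : ℝ))

end ThreeAP

namespace ThreeAP

open Finset Module

/-! ### Fourier analysis over the dual space -/

section Fourier

variable {p : ℕ} [Fact p.Prime] {V : Type*} [AddCommGroup V] [Module (ZMod p) V] [Fintype V]

/-! Let `p` be odd. Averaging `f` over the common kernel `W` of its large frequencies changes `Λ₃`
by at most `Δ` (`exists_submodule_Lambda3_cosetMean_le`), and `F = f_W` is constant along `W`. As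
`f` is far from `F`, the function `F` cannot be nearly 0/1-valued: it lies in `[ε/4, 1 - ε/4]` on a
set `T` of density above `ε`. This leaves room to add `(ε/4) 1_T(m) λ(l m)`, where `l` is nonzero on
`W` and `λ` on `ZMod p` has mean zero and `Λ₃(λ) ≤ -1/64` (`exists_Lambda3_le_neg`).

Since `F` and `1_T` do not vary along `W`, the mixed terms cancel and `Λ₃` changes by exactly
`(ε/4)³ Λ₃(1_T) Λ₃(λ)` (`Lambda3_add_mul`). A Varnavides average of Meshulam's theorem
(`density_sub_le_Lambda3`) bounds `Λ₃(1_T)` below, so the loss exceeds `2Δ`: one `Δ` repays the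
passage to `F`, the other is the claim.

For `p = 2`, progressions degenerate to `m, m + d, m`, and the constant function `𝔼(f)` already
suffices. Meshulam's theorem is proved by density increment on hyperplanes. -/

noncomputable instance instFintypeDual : Fintype (Dual (ZMod p) V) :=
  haveI : Finite (Dual (ZMod p) V) := DFunLike.finite _
  Fintype.ofFinite _

lemma card_dual : Fintype.card (Dual (ZMod p) V) = Fintype.card V := by
  rw [card_eq_pow_finrank (K := ZMod p) (V := Dual (ZMod p) V),
    card_eq_pow_finrank (K := ZMod p) (V := V), Subspace.dual_finrank_eq]

lemma card_ne_zero_real : (Fintype.card V : ℝ) ≠ 0 := by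
  exact_mod_cast Fintype.card_ne_zero

lemma card_pos_real : (0 : ℝ) < Fintype.card V := by
  exact_mod_cast Fintype.card_pos

lemma stdAddChar_ne_one {x : ZMod p} (hx : x ≠ 0) : ZMod.stdAddChar x ≠ (1 : ℂ) := by
  intro h
  exact hx (ZMod.injective_stdAddChar (h.trans (AddChar.map_zero_eq_one _).symm))

/-- Summing a nontrivial character over a finite group gives zero. -/
lemma sum_stdAddChar_comp_eq_zero {G : Type*} [AddCommGroup G] [Fintype G] (φ : G →+ ZMod p)
    {a : G} (ha : φ a ≠ 0) : ∑ x : G, (ZMod.stdAddChar (φ x) : ℂ) = 0 := by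
  have h := (AddChar.sum_eq_zero_iff_ne_zero
    (ψ := (ZMod.stdAddChar (N := p)).compAddMonoidHom φ)).2 (by
      intro h0
      apply stdAddChar_ne_one ha
      have := DFunLike.congr_fun h0 a
      simpa using this)
  simpa using h

lemma exists_dual_apply_ne_zero {x : V} (hx : x ≠ 0) : ∃ l : Dual (ZMod p) V, l x ≠ 0 := by
  by_contra! h
  exact hx ((forall_dual_apply_eq_zero_iff (ZMod p) x).1 h)

open Classical in
lemma sum_dual_stdAddChar (x : V) :
    ∑ l : Dual (ZMod p) V, (ZMod.stdAddChar (l x) : ℂ) =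
      if x = 0 then (Fintype.card V : ℂ) else 0 := by
  split_ifs with hx
  · simp [hx, card_dual]
  · obtain ⟨l, hl⟩ := exists_dual_apply_ne_zero (p := p) hx
    exact sum_stdAddChar_comp_eq_zero (G := Dual (ZMod p) V)
      ⟨⟨fun l => l x, by simp⟩, by simp⟩ (a := l) hl

/-- The normalised Fourier coefficient of `f` at the linear functional `l`. -/
noncomputable def hat (f : V → ℝ) (l : Dual (ZMod p) V) : ℂ :=
  (Fintype.card V : ℂ)⁻¹ * ∑ m : V, (f m : ℂ) * ZMod.stdAddChar (l m)

lemma hat_sub (f g : V → ℝ) (l : Dual (ZMod p) V) :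
    hat (fun m => f m - g m) l = hat f l - hat g l := by
  simp [hat, sub_mul, mul_sub, sum_sub_distrib]

lemma hat_mul_hat_eq (f g : V → ℝ) (l l' : Dual (ZMod p) V) :
    hat f l * hat g l' = ((Fintype.card V : ℂ) ^ 2)⁻¹ *
      ∑ x : V, ∑ y : V, ((f x * g y : ℝ) : ℂ) * ZMod.stdAddChar (l x + l' y) := by
  rw [hat, hat, mul_mul_mul_comm, sum_mul_sum, ← mul_inv, ← sq]
  congr 1
  refine sum_congr rfl fun x _ => sum_congr rfl fun y _ => ?_
  rw [AddChar.map_add_eq_mul]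
  push_cast
  ring

/-- Parseval: summing over `l` first leaves only the diagonal `x = y`. -/
lemma sum_sq_norm_hat (f : V → ℝ) :
    ∑ l : Dual (ZMod p) V, ‖hat f l‖ ^ 2 = mean (fun m => f m ^ 2) := by
  classical
  have key : ∀ l : Dual (ZMod p) V, ((‖hat f l‖ ^ 2 : ℝ) : ℂ) = ((Fintype.card V : ℂ) ^ 2)⁻¹ *
      ∑ x : V, ∑ y : V, ((f x * f y : ℝ) : ℂ) * ZMod.stdAddChar (l (x - y)) := by
    intro l
    have h : hat f (-l) = (starRingEnd ℂ) (hat f l) := by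
      simp [hat, AddChar.map_neg_eq_conj, map_sum]
    rw [Complex.ofReal_pow, ← Complex.mul_conj', ← h, hat_mul_hat_eq]
    simp [sub_eq_add_neg]
  have hN : (Fintype.card V : ℂ) ≠ 0 := by exact_mod_cast Fintype.card_ne_zero
  apply Complex.ofReal_injective
  rw [Complex.ofReal_sum]
  simp_rw [key]
  rw [← mul_sum, sum_comm]
  have : ∀ x : V, ∑ l : Dual (ZMod p) V, ∑ y : V,
      ((f x * f y : ℝ) : ℂ) * (ZMod.stdAddChar (l (x - y)) : ℂ) =
        (Fintype.card V : ℂ) * ((f x ^ 2 : ℝ) : ℂ) := by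
    intro x
    rw [sum_comm]
    simp_rw [← mul_sum, sum_dual_stdAddChar, sub_eq_zero, mul_ite, mul_zero]
    rw [sum_ite_eq]
    simp
    ring
  simp_rw [this]
  rw [← mul_sum, mean]
  push_cast
  field_simp

/-- Progressions are the triples with `x - 2y + z = 0`; orthogonality of characters detects this
equation. -/
lemma Lambda3_eq_sum_hat (f : V → ℝ) :
    (Lambda3 f : ℂ) = ∑ l : Dual (ZMod p) V, hat f l ^ 2 * hat f ((-2 : ZMod p) • l) := by
  classical
  have key : ∀ l : Dual (ZMod p) V, hat f l ^ 2 * hat f ((-2 : ZMod p) • l) =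
      ((Fintype.card V : ℂ) ^ 3)⁻¹ * ∑ x : V, ∑ y : V, ∑ z : V,
        ((f x * f y * f z : ℝ) : ℂ) * ZMod.stdAddChar (l (z - (2 • y - x))) := by
    intro l
    rw [sq, mul_right_comm, hat_mul_hat_eq, hat, mul_mul_mul_comm, ← mul_inv, ← pow_succ]
    congr 1
    simp_rw [sum_mul_sum, sum_mul]
    refine sum_congr rfl fun x _ => ?_
    rw [sum_comm]
    refine sum_congr rfl fun y _ => ?_
    refine sum_congr rfl fun z _ => ?_
    have : l (z - (2 • y - x)) = l x + ((-2 : ZMod p) • l) y + l z := by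
      simp only [map_sub, map_nsmul, LinearMap.smul_apply, smul_eq_mul, nsmul_eq_mul]
      push_cast
      ring
    rw [this, AddChar.map_add_eq_mul _ (l x + _)]
    push_cast
    ring
  have hN : (Fintype.card V : ℂ) ≠ 0 := by exact_mod_cast Fintype.card_ne_zero
  simp_rw [key]
  rw [← mul_sum, sum_comm]
  have : ∀ x : V, ∑ l : Dual (ZMod p) V, ∑ y : V, ∑ z : V,
      ((f x * f y * f z : ℝ) : ℂ) * (ZMod.stdAddChar (l (z - (2 • y - x))) : ℂ) =
        (Fintype.card V : ℂ) * ((∑ d : V, f x * f (x + d) * f (x + 2 • d) : ℝ) : ℂ) := by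
    intro x
    rw [sum_comm, Complex.ofReal_sum, mul_sum, ← Equiv.sum_comp (Equiv.addLeft x)]
    refine sum_congr rfl fun d _ => ?_
    rw [sum_comm]
    simp_rw [← mul_sum, sum_dual_stdAddChar, sub_eq_zero, mul_ite, mul_zero]
    rw [sum_ite_eq']
    have : 2 • (x + d) - x = x + 2 • d := by abel
    simp only [Equiv.coe_addLeft, this, mem_univ, if_true]
    push_cast
    ring
  simp_rw [this]
  rw [← mul_sum, Lambda3]
  push_cast
  field_simp

lemma two_ne_zero_zmod (hp : p ≠ 2) : (2 : ZMod p) ≠ 0 := by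
  intro h
  have h' : ((2 : ℕ) : ZMod p) = 0 := by exact_mod_cast h
  rw [ZMod.natCast_eq_zero_iff] at h'
  exact hp ((Nat.prime_dvd_prime_iff_eq Fact.out Nat.prime_two).1 h')

/-- One Fourier factor is bounded by `η`; Parseval handles the other two. -/
lemma abs_Lambda3_le (h : V → ℝ) {η : ℝ}
    (hη : ∀ l : Dual (ZMod p) V, ‖hat h l‖ ≤ η) :
    |Lambda3 h| ≤ η * mean (fun m => h m ^ 2) := by
  have e1 : |Lambda3 h| = ‖(Lambda3 h : ℂ)‖ := by simp
  rw [e1, Lambda3_eq_sum_hat (p := p)]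
  calc ‖∑ l : Dual (ZMod p) V, hat h l ^ 2 * hat h ((-2 : ZMod p) • l)‖
      ≤ ∑ l : Dual (ZMod p) V, ‖hat h l ^ 2 * hat h ((-2 : ZMod p) • l)‖ := norm_sum_le _ _
    _ ≤ ∑ l : Dual (ZMod p) V, η * ‖hat h l‖ ^ 2 := by
        refine sum_le_sum fun l _ => ?_
        rw [norm_mul, norm_pow, mul_comm]
        exact mul_le_mul_of_nonneg_right (hη _) (by positivity)
    _ = _ := by rw [← mul_sum, sum_sq_norm_hat]

open Classical in
-- Averaging over `W` is a convolution, so it multiplies each coefficient by the average of a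
-- character over `W`: 1 if `l` vanishes on `W`, 0 otherwise.
lemma hat_cosetMean_eq (W : Submodule (ZMod p) V) (f : V → ℝ) (l : Dual (ZMod p) V) :
    hat (cosetMean W f) l = hat f l *
      ((Fintype.card W : ℂ)⁻¹ * ∑ w : W, ZMod.stdAddChar (l (-(w : V)))) := by
  have h : ∀ w : W, ∑ m : V, (f (m + w) : ℂ) * ZMod.stdAddChar (l m) =
      (∑ m : V, (f m : ℂ) * ZMod.stdAddChar (l m)) * ZMod.stdAddChar (l (-(w : V))) := by
    intro w
    rw [sum_mul, ← Equiv.sum_comp (Equiv.addRight (w : V))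
      (fun m => (f m : ℂ) * ZMod.stdAddChar (l m) * ZMod.stdAddChar (l (-(w : V))))]
    refine sum_congr rfl fun m _ => ?_
    rw [mul_assoc, ← AddChar.map_add_eq_mul, ← map_add]
    simp
  have h' : ∀ m : V, (cosetMean W f m : ℂ) * ZMod.stdAddChar (l m) =
      (Fintype.card W : ℂ)⁻¹ * ∑ w : W, (f (m + w) : ℂ) * ZMod.stdAddChar (l m) := by
    intro m
    rw [cosetMean, ← sum_mul, ← mul_assoc]
    push_cast
    rfl
  rw [hat, hat]
  simp_rw [h']
  rw [← mul_sum, sum_comm]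
  simp_rw [h, ← mul_sum]
  ring

lemma hat_cosetMean_of_forall (W : Submodule (ZMod p) V) (f : V → ℝ) {l : Dual (ZMod p) V}
    (hl : ∀ w ∈ W, l w = 0) : hat (cosetMean W f) l = hat f l := by
  classical
  rw [hat_cosetMean_eq]
  have : ∀ w : W, (ZMod.stdAddChar (l (-(w : V))) : ℂ) = 1 := by
    intro w
    rw [map_neg, hl w w.2, neg_zero, AddChar.map_zero_eq_one]
  simp_rw [this]
  simp

lemma hat_cosetMean_of_ne (W : Submodule (ZMod p) V) (f : V → ℝ) {l : Dual (ZMod p) V}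
    {w : V} (hw : w ∈ W) (hl : l w ≠ 0) : hat (cosetMean W f) l = 0 := by
  classical
  rw [hat_cosetMean_eq]
  have := sum_stdAddChar_comp_eq_zero (p := p) (G := W)
    (-(l.comp W.subtype)).toAddMonoidHom (a := ⟨w, hw⟩) (by simpa using hl)
  have h2 : ∑ w : W, (ZMod.stdAddChar (l (-(w : V))) : ℂ) = 0 := by
    rw [← this]
    refine sum_congr rfl fun w _ => ?_
    simp
  rw [h2]
  simp

/-- The spectrum of `f_W` lies in the annihilator of `W`, that of `f - f_W` in its complement. For
odd `p`, `l` and `-2l` lie on the same side, so no mixed terms survive. -/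
lemma Lambda3_eq_add_Lambda3_sub_cosetMean (hp : p ≠ 2) (W : Submodule (ZMod p) V) (f : V → ℝ) :
    Lambda3 f = Lambda3 (cosetMean W f) + Lambda3 (fun m => f m - cosetMean W f m) := by
  apply Complex.ofReal_injective
  rw [Complex.ofReal_add, Lambda3_eq_sum_hat (p := p), Lambda3_eq_sum_hat (p := p),
    Lambda3_eq_sum_hat (p := p), ← sum_add_distrib]
  refine sum_congr rfl fun l _ => ?_
  simp_rw [hat_sub]
  by_cases h : ∀ w ∈ W, l w = 0
  · rw [hat_cosetMean_of_forall W f h, hat_cosetMean_of_forall W f (l := (-2 : ZMod p) • l)]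
    · ring
    · intro w hw
      simp [h w hw]
  · push Not at h
    obtain ⟨w, hw, hl⟩ := h
    rw [hat_cosetMean_of_ne W f hw hl, hat_cosetMean_of_ne W f (l := (-2 : ZMod p) • l) hw]
    · ring
    · simp [hl, two_ne_zero_zmod hp]

lemma mean_le_of_forall_le {g : V → ℝ} {c : ℝ} (h : ∀ m, g m ≤ c) : mean g ≤ c := by
  rw [mean, inv_mul_le_iff₀ card_pos_real]
  calc ∑ m, g m ≤ ∑ _m : V, c := sum_le_sum fun m _ => h m
    _ = _ := by simp

lemma cosetMean_mem_Icc (W : Submodule (ZMod p) V) {f : V → ℝ}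
    (hf : ∀ m, f m ∈ Set.Icc (0 : ℝ) 1) (m : V) : cosetMean W f m ∈ Set.Icc (0 : ℝ) 1 := by
  classical
  rw [cosetMean]
  constructor
  · have := sum_nonneg (s := univ) fun (w : W) _ => (hf (m + w)).1
    positivity
  · exact mean_le_of_forall_le (V := W) (g := fun w => f (m + w)) fun w => (hf _).2

/-- A function with values in `[0, 1]` has about the same number of three-term progressions as
its average over the cosets of some subspace of bounded codimension. -/
lemma exists_submodule_Lambda3_cosetMean_le (hp : p ≠ 2) {f : V → ℝ}
    (hf : ∀ m, f m ∈ Set.Icc (0 : ℝ) 1) {η : ℝ} (hη : 0 < η) :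
    ∃ W : Submodule (ZMod p) V, (finrank (ZMod p) (V ⧸ W) : ℝ) ≤ η ^ (-2 : ℤ) ∧
      Lambda3 (cosetMean W f) ≤ Lambda3 f + η := by
  classical
  -- The large spectrum; Parseval gives it at most `η⁻²` elements, which bounds the codimension of
  -- their common kernel.
  set L : Finset (Dual (ZMod p) V) := univ.filter fun l => η ≤ ‖hat f l‖ with hL
  have hcard : (L.card : ℝ) * η ^ 2 ≤ 1 := by
    calc (L.card : ℝ) * η ^ 2 = ∑ _l ∈ L, η ^ 2 := by simp
      _ ≤ ∑ l ∈ L, ‖hat f l‖ ^ 2 := by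
        refine sum_le_sum fun l hl => ?_
        exact pow_le_pow_left₀ hη.le (mem_filter.1 hl).2 2
      _ ≤ ∑ l, ‖hat f l‖ ^ 2 := sum_le_univ_sum_of_nonneg fun l => by positivity
      _ ≤ 1 := by
        rw [sum_sq_norm_hat]
        exact mean_le_of_forall_le fun m => pow_le_one₀ (hf m).1 (hf m).2
  set Φ : V →ₗ[ZMod p] (L → ZMod p) := LinearMap.pi fun l => (l : Dual (ZMod p) V) with hΦ
  have hmem : ∀ {w : V}, w ∈ LinearMap.ker Φ → ∀ l ∈ L, l w = 0 := by
    intro w hw l hl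
    exact congr_fun (LinearMap.mem_ker.1 hw) ⟨l, hl⟩
  refine ⟨LinearMap.ker Φ, ?_, ?_⟩
  · have h1 : finrank (ZMod p) (V ⧸ LinearMap.ker Φ) ≤ L.card := by
      rw [Φ.quotKerEquivRange.finrank_eq]
      refine (Submodule.finrank_le _).trans ?_
      simp
    have h2 : (L.card : ℝ) ≤ η ^ (-2 : ℤ) := by
      rw [zpow_neg, ← one_div, le_div_iff₀ (by positivity)]
      exact_mod_cast hcard
    exact le_trans (by exact_mod_cast h1) h2
  · have h1 := abs_Lambda3_le (p := p) (fun m => f m - cosetMean (LinearMap.ker Φ) f m) (η := η) (by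
      intro l
      rw [hat_sub]
      by_cases h : ∀ w ∈ LinearMap.ker Φ, l w = 0
      · rw [hat_cosetMean_of_forall _ f h, sub_self, norm_zero]
        exact hη.le
      · push Not at h
        obtain ⟨w, hw, hl⟩ := h
        rw [hat_cosetMean_of_ne _ f hw hl, sub_zero]
        by_contra! hlt
        exact hl (hmem hw l (mem_filter.2 ⟨mem_univ _, hlt.le⟩)))
    have h2 : mean (fun m => (f m - cosetMean (LinearMap.ker Φ) f m) ^ 2) ≤ 1 := by
      refine mean_le_of_forall_le fun m => ?_
      have a := hf m
      have b := cosetMean_mem_Icc (LinearMap.ker Φ) hf m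
      rw [← sq_abs]
      refine pow_le_one₀ (abs_nonneg _) (abs_le.2 ⟨?_, ?_⟩) <;> linarith [a.1, a.2, b.1, b.2]
    have h3 := Lambda3_eq_add_Lambda3_sub_cosetMean hp (LinearMap.ker Φ) f
    have h4 := neg_abs_le (Lambda3 fun m => f m - cosetMean (LinearMap.ker Φ) f m)
    nlinarith

end Fourier

open Classical in
/-- The indicator function of a finite set. -/
noncomputable def ind {V : Type*} (S : Finset V) (m : V) : ℝ := if m ∈ S then 1 else 0

lemma mean_ind {V : Type*} [Fintype V] (S : Finset V) : mean (ind S) = S.card / Fintype.card V := by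
  classical
  simp [mean, ind, div_eq_inv_mul]

lemma mul_ind_ind_ind {V : Type*} (S : Finset V) (x y z : V) [Decidable (x ∈ S ∧ y ∈ S ∧ z ∈ S)] :
    ind S x * ind S y * ind S z = if x ∈ S ∧ y ∈ S ∧ z ∈ S then 1 else 0 := by
  classical
  by_cases hx : x ∈ S <;> by_cases hy : y ∈ S <;> by_cases hz : z ∈ S <;> simp [ind, hx, hy, hz]

/-! ### Progression-free sets and their large Fourier coefficients -/

section Basic

variable {p : ℕ} [Fact p.Prime] {V : Type*} [AddCommGroup V] [Module (ZMod p) V] [Fintype V]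

lemma cosetMean_top (f : V → ℝ) (m : V) :
    cosetMean (⊤ : Submodule (ZMod p) V) f m = mean f := by
  classical
  have h1 : Fintype.card (⊤ : Submodule (ZMod p) V) = Fintype.card V :=
    Fintype.card_congr (Submodule.topEquiv (R := ZMod p) (M := V)).toEquiv
  have h2 : ∑ w : (⊤ : Submodule (ZMod p) V), f (m + w) = ∑ v, f v := by
    rw [← Equiv.sum_comp (Equiv.addLeft m) f]
    exact Fintype.sum_equiv (Submodule.topEquiv (R := ZMod p) (M := V)).toEquiv _ _ fun w => rfl
  rw [cosetMean, mean, h2, h1]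

lemma Lambda3_const (a : ℝ) : Lambda3 (fun _ : V => a) = a ^ 3 := by
  have := card_ne_zero_real (V := V)
  simp [Lambda3]
  field_simp

/-- The set contains no nontrivial three-term arithmetic progression. -/
def APFree {G : Type*} [AddCommGroup G] (S : Finset G) : Prop :=
  ∀ m d, m ∈ S → m + d ∈ S → m + 2 • d ∈ S → d = 0

lemma Lambda3_ind_of_APFree {S : Finset V} (hS : APFree S) :
    Lambda3 (ind S) = S.card / (Fintype.card V : ℝ) ^ 2 := by
  classical
  have : ∀ m : V, ∑ d : V, ind S m * ind S (m + d) * ind S (m + 2 • d) =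
      if m ∈ S then 1 else 0 := by
    intro m
    rw [sum_eq_single 0]
    · by_cases hm : m ∈ S <;> simp [ind, hm]
    · intro d _ hd
      rw [mul_ind_ind_ind, if_neg]
      rintro ⟨h1, h2, h3⟩
      exact hd (hS m d h1 h2 h3)
    · simp
  simp_rw [Lambda3, this]
  simp [div_eq_inv_mul]

lemma hat_ind (S : Finset V) (l : Dual (ZMod p) V) :
    hat (ind S) l = (Fintype.card V : ℂ)⁻¹ *
      ∑ j : ZMod p, ((S.filter fun m => l m = j).card : ℂ) * ZMod.stdAddChar j := by
  classical
  rw [hat]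
  congr 1
  have : ∑ m : V, (ind S m : ℂ) * (ZMod.stdAddChar (l m) : ℂ) =
      ∑ m ∈ S, (ZMod.stdAddChar (l m) : ℂ) := by
    have h : ∀ m, (ind S m : ℂ) * (ZMod.stdAddChar (l m) : ℂ) =
        if m ∈ S then ZMod.stdAddChar (l m) else 0 := by
      intro m
      by_cases hm : m ∈ S <;> simp [ind, hm]
    simp_rw [h]
    rw [sum_ite_mem, univ_inter]
  rw [this, ← sum_fiberwise (s := S) (g := fun m => l m)]
  refine sum_congr rfl fun j _ => ?_
  rw [sum_congr rfl (g := fun _ => (ZMod.stdAddChar j : ℂ)), sum_const, nsmul_eq_mul]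
  intro m hm
  rw [(mem_filter.1 hm).2]

/-- A large nonzero Fourier coefficient forces a fibre on which the set is dense. -/
lemma norm_hat_ind_le {S : Finset V} {l : Dual (ZMod p) V} {M : ℝ}
    (hM : ∀ j, ((S.filter fun m => l m = j).card : ℝ) ≤ S.card / p + M) :
    ‖hat (ind S) l‖ ≤ (Fintype.card V : ℝ)⁻¹ * (2 * p * M) := by
  classical
  have hp0 : (p : ℝ) ≠ 0 := by exact_mod_cast (Fact.out : p.Prime).ne_zero
  set c : ZMod p → ℝ := fun j => ((S.filter fun m => l m = j).card : ℝ) with hc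
  have hsum : ∑ j, (c j - S.card / p) = 0 := by
    rw [sum_sub_distrib]
    have : ∑ j, c j = S.card := by
      simp only [hc]
      exact_mod_cast (card_eq_sum_card_fiberwise (f := fun m => l m) (s := S) (t := univ)
        (by intro x _; simp)).symm
    rw [this]
    simp [ZMod.card]
    field_simp
    simp
  have hM0 : 0 ≤ M := by
    by_contra! h
    have : ∑ j : ZMod p, (c j - S.card / p) < ∑ _j : ZMod p, (0 : ℝ) :=
      sum_lt_sum_of_nonempty univ_nonempty fun j _ => by
        have := hM j
        simp only [hc]
        linarith
    simp [hsum] at this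
  have hchar : ∑ j : ZMod p, (ZMod.stdAddChar j : ℂ) = 0 :=
    sum_stdAddChar_comp_eq_zero (AddMonoidHom.id (ZMod p)) (a := 1) (by simp)
  have h1 : hat (ind S) l = (Fintype.card V : ℂ)⁻¹ *
      ∑ j : ZMod p, ((c j - S.card / p : ℝ) : ℂ) * ZMod.stdAddChar j := by
    rw [hat_ind]
    congr 1
    simp_rw [Complex.ofReal_sub, sub_mul, sum_sub_distrib, ← mul_sum, hchar]
    simp [hc]
  rw [h1, norm_mul, norm_inv, Complex.norm_natCast]
  refine mul_le_mul_of_nonneg_left ?_ (by positivity)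
  calc ‖∑ j : ZMod p, ((c j - S.card / p : ℝ) : ℂ) * (ZMod.stdAddChar j : ℂ)‖
      ≤ ∑ j : ZMod p, ‖((c j - S.card / p : ℝ) : ℂ) * (ZMod.stdAddChar j : ℂ)‖ := norm_sum_le _ _
    -- If `x ≤ M` and `M ≥ 0` then `|x| ≤ 2M - x`; the deviations `x` sum to zero.
    _ ≤ ∑ j : ZMod p, (2 * M - (c j - S.card / p)) := by
        refine sum_le_sum fun j _ => ?_
        rw [norm_mul, AddChar.norm_apply, mul_one, Complex.norm_real, Real.norm_eq_abs]
        have := hM j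
        simp only [hc]
        exact abs_le.2 ⟨by linarith, by linarith⟩
    _ = 2 * p * M := by
        rw [sum_sub_distrib, hsum]
        simp [ZMod.card]
        ring

/-- Only trivial progressions occur, so `Λ₃(1_S) ≤ α³/2` once `|S|² ≥ 2|V|`. The deficit from `α³`
comes from nonzero frequencies; were these all at most `α²/2`, it would be at most `(α²/2)(α - α²) <
α³/2`. -/
lemma exists_norm_hat_ind_ge (hp : p ≠ 2) {S : Finset V} (hS : APFree S) (h0 : 0 < S.card)
    (hN : 2 * (Fintype.card V : ℝ) ≤ (S.card : ℝ) ^ 2) :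
    ∃ l : Dual (ZMod p) V, l ≠ 0 ∧
      ((S.card : ℝ) / Fintype.card V) ^ 2 / 2 < ‖hat (ind S) l‖ := by
  classical
  set α : ℝ := (S.card : ℝ) / Fintype.card V with hα
  have hNpos := card_pos_real (V := V)
  have hSpos : (0 : ℝ) < S.card := by exact_mod_cast h0
  have hα0 : 0 < α := by positivity
  have hcm : ∀ m, cosetMean (⊤ : Submodule (ZMod p) V) (ind S) m = α := fun m => by
    rw [cosetMean_top, mean_ind]
  have hΛ := Lambda3_eq_add_Lambda3_sub_cosetMean hp (⊤ : Submodule (ZMod p) V) (ind S)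
  have hc : Lambda3 (cosetMean (⊤ : Submodule (ZMod p) V) (ind S)) = α ^ 3 := by
    rw [funext hcm, Lambda3_const]
  rw [hc, Lambda3_ind_of_APFree hS] at hΛ
  have hsmall : (S.card : ℝ) / (Fintype.card V : ℝ) ^ 2 ≤ α ^ 3 / 2 := by
    rw [hα, div_pow, div_div, div_le_div_iff₀ (by positivity) (by positivity)]
    nlinarith [mul_le_mul_of_nonneg_left hN (by positivity :
      (0 : ℝ) ≤ (S.card : ℝ) * (Fintype.card V : ℝ) ^ 2)]
  by_contra! hcon
  have hle := abs_Lambda3_le (p := p)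
    (fun m => ind S m - cosetMean (⊤ : Submodule (ZMod p) V) (ind S) m) (η := α ^ 2 / 2) (by
      intro l
      rw [hat_sub]
      by_cases hl : l = 0
      · rw [hat_cosetMean_of_forall _ _ (by simp [hl]), sub_self, norm_zero]
        positivity
      · obtain ⟨w, hw⟩ := DFunLike.ne_iff.1 hl
        rw [hat_cosetMean_of_ne _ _ (Submodule.mem_top (x := w)) hw, sub_zero]
        exact hcon l hl)
  have hvar : mean (fun m => (ind S m - cosetMean (⊤ : Submodule (ZMod p) V) (ind S) m) ^ 2) =
      α - α ^ 2 := by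
    have h1 : ∀ m, (ind S m - cosetMean (⊤ : Submodule (ZMod p) V) (ind S) m) ^ 2 =
        (1 - 2 * α) * ind S m + α ^ 2 := by
      intro m
      rw [hcm]
      by_cases hm : m ∈ S <;> simp [ind, hm]
      ring
    have h2 := mean_ind S
    rw [← hα, mean] at h2
    simp_rw [mean, h1, sum_add_distrib, ← mul_sum]
    rw [mul_add, mul_left_comm, h2]
    simp
    field_simp
    ring
  rw [hvar] at hle
  have := neg_abs_le (Lambda3 fun m => ind S m - cosetMean (⊤ : Submodule (ZMod p) V) (ind S) m)
  nlinarith [pow_pos hα0 4]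

end Basic

/-! ### Meshulam's theorem by induction on dimension -/

section Meshulam

variable {p : ℕ} [Fact p.Prime]

lemma APFree.fiber {V : Type*} [AddCommGroup V] [Module (ZMod p) V] [Fintype V]
    {S : Finset V} (hS : APFree S) {l : Dual (ZMod p) V} (hl : l ≠ 0) (j : ZMod p) :
    ∃ S' : Finset (LinearMap.ker l), APFree S' ∧ S'.card = (S.filter fun m => l m = j).card := by
  classical
  obtain ⟨v, hv⟩ := LinearMap.surjective hl j
  refine ⟨univ.filter fun w => v + (w : V) ∈ S, ?_, ?_⟩
  · intro m d h1 h2 h3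
    simp only [mem_filter, mem_univ, true_and, Submodule.coe_add] at h1 h2 h3
    rw [← add_assoc] at h2 h3
    exact Subtype.ext (hS (v + m) d h1 h2 h3)
  · refine card_bij (fun w _ => v + (w : V)) ?_ ?_ ?_
    · intro w hw
      have := LinearMap.mem_ker.1 w.2
      simpa [hv, this] using hw
    · intro a _ b _ h
      exact Subtype.ext (add_left_cancel h)
    · intro m hm
      obtain ⟨h1, h2⟩ := mem_filter.1 hm
      refine ⟨⟨m - v, by simp [h2, hv]⟩, by simpa using h1, by simp⟩

/-- **Meshulam's theorem**, with constant `8`. -/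
theorem card_mul_le_of_APFree (hp : p ≠ 2) (n : ℕ) :
    ∀ (V : Type) [AddCommGroup V] [Module (ZMod p) V] [Fintype V], finrank (ZMod p) V = n →
      ∀ S : Finset V, APFree S → (S.card : ℝ) * n ≤ 8 * Fintype.card V := by
  classical
  induction n with
  | zero => intro V _ _ _ _ S _; simp
  | succ n ih =>
    intro V _ _ _ hV S hS
    have hSV : (S.card : ℝ) ≤ Fintype.card V := by exact_mod_cast card_le_univ S
    have hNpos := card_pos_real (V := V)
    -- In dimension at most 8 the bound is weaker than `|S| ≤ |V|`.
    by_cases hn : n + 1 ≤ 8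
    · have : ((n + 1 : ℕ) : ℝ) ≤ 8 := by exact_mod_cast hn
      nlinarith [Nat.cast_nonneg (α := ℝ) S.card]
    have hn8 : (8 : ℝ) ≤ n := by exact_mod_cast (by omega : 8 ≤ n)
    by_contra! hlt
    push_cast at hlt
    have hS0 : 0 < S.card := by
      rcases Nat.eq_zero_or_pos S.card with h | h
      · rw [h] at hlt
        simp at hlt
        linarith
      · exact h
    have hSpos : (0 : ℝ) < S.card := by exact_mod_cast hS0
    have hp2 : 2 ≤ p := (Fact.out : p.Prime).two_le
    have hp0 : (0 : ℝ) < p := by positivity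
    have hcardV : Fintype.card V = p ^ (n + 1) := by
      rw [card_eq_pow_finrank (K := ZMod p) (V := V), hV, ZMod.card]
    have hbig : ((n : ℝ) + 1) ^ 2 ≤ 32 * Fintype.card V := by
      have h1 : (n + 1) ^ 2 ≤ 32 * 2 ^ (n + 1) := by
        have : ∀ k : ℕ, k ^ 2 ≤ 32 * 2 ^ k := by
          intro k
          induction k with
          | zero => simp
          | succ k ihk =>
            rcases le_or_gt k 2 with h | h
            · interval_cases k <;> norm_num
            · rw [pow_succ 2]; nlinarith
        exact this _
      have h2 : 2 ^ (n + 1) ≤ Fintype.card V := by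
        rw [hcardV]; exact Nat.pow_le_pow_left hp2 _
      have h3 : (n + 1) ^ 2 ≤ 32 * Fintype.card V := h1.trans (by omega)
      exact_mod_cast h3
    have hN : 2 * (Fintype.card V : ℝ) ≤ (S.card : ℝ) ^ 2 := by
      have h1 : (8 * (Fintype.card V : ℝ)) ^ 2 ≤ ((S.card : ℝ) * (n + 1)) ^ 2 :=
        pow_le_pow_left₀ (by positivity) hlt.le 2
      have h2 : (S.card : ℝ) ^ 2 * (n + 1) ^ 2 ≤ (S.card : ℝ) ^ 2 * (32 * Fintype.card V) :=
        mul_le_mul_of_nonneg_left hbig (by positivity)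
      have h3 : (Fintype.card V : ℝ) * (2 * (Fintype.card V : ℝ)) ≤
          (Fintype.card V : ℝ) * (S.card : ℝ) ^ 2 := by nlinarith
      exact le_of_mul_le_mul_left h3 hNpos
    obtain ⟨l, hl, hlarge⟩ := exists_norm_hat_ind_ge (p := p) hp hS hS0 hN
    have hker : finrank (ZMod p) (LinearMap.ker l) = n := by
      have := Module.Dual.finrank_ker_add_one_of_ne_zero hl
      omega
    have hcardK : (p : ℝ) * Fintype.card (LinearMap.ker l) = Fintype.card V := by
      rw [hcardV, card_eq_pow_finrank (K := ZMod p) (V := LinearMap.ker l), hker, ZMod.card]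
      push_cast
      ring
    -- Each fibre is a translate of a progression-free subset of `ker l`, so induction bounds it;
    -- the bound is written as the average `|S|/p` plus an excess, as `norm_hat_ind_le` needs.
    have hfib : ∀ j, ((S.filter fun m => l m = j).card : ℝ) ≤
        S.card / p + (8 * Fintype.card V / n - S.card) / p := by
      intro j
      obtain ⟨S', hS', hcard⟩ := hS.fiber hl j
      have := ih (LinearMap.ker l) hker S' hS'
      rw [hcard] at this
      rw [← add_div, add_sub_cancel, ← hcardK]
      have e : 8 * ((p : ℝ) * Fintype.card (LinearMap.ker l)) / n / p =
          8 * Fintype.card (LinearMap.ker l) / n := by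
        field_simp
      rw [e, le_div_iff₀ (by linarith)]
      exact this
    have hle := norm_hat_ind_le hfib
    set α : ℝ := (S.card : ℝ) / Fintype.card V with hα
    have e : (Fintype.card V : ℝ)⁻¹ * (2 * p * ((8 * Fintype.card V / n - S.card) / p)) =
        2 * (8 / n - α) := by
      rw [hα]
      field_simp
    rw [e] at hle
    have hα1 : 8 / ((n : ℝ) + 1) < α := by
      rw [hα, div_lt_div_iff₀ (by positivity) hNpos]
      linarith
    have hα2 : (8 / ((n : ℝ) + 1)) ^ 2 < α ^ 2 :=
      pow_lt_pow_left₀ hα1 (by positivity) (by norm_num)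
    -- The two Fourier bounds give `α²/2 < 2(8/n - α)`, that is `α²/4 + α < 8/n`, while `α >
    -- 8/(n+1)`.
    have h1 : (8 / ((n : ℝ) + 1)) ^ 2 / 4 + 8 / ((n : ℝ) + 1) < 8 / n := by linarith
    have h2 : 8 / (n : ℝ) ≤ (8 / ((n : ℝ) + 1)) ^ 2 / 4 + 8 / ((n : ℝ) + 1) := by
      rw [div_pow, div_div, div_add_div _ _ (by positivity) (by positivity),
        div_le_div_iff₀ (by linarith) (by positivity)]
      nlinarith [mul_pos (by linarith : (0 : ℝ) < n) (by linarith : (0 : ℝ) < n + 1),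
        mul_nonneg (mul_pos (by linarith : (0 : ℝ) < n) (by linarith : (0 : ℝ) < n + 1)).le
          (by linarith : (0 : ℝ) ≤ n)]
    linarith

/-- Meshulam constants exist. -/
theorem isMeshulamConstant_nine : IsMeshulamConstant p 9 := by
  classical
  -- The bound with 8 is not strict, so a constant above 8 is needed for a contradiction.
  refine ⟨by norm_num, fun n hn S hS => ?_⟩
  have hp2 : 2 ≤ p := (Fact.out : p.Prime).two_le
  have hn0 : (0 : ℝ) < n := by exact_mod_cast hn
  have hpn : (0 : ℝ) < (p : ℝ) ^ n := by positivity
  rw [div_le_iff₀ hn0] at hS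
  -- In characteristic two any distinct `a, b` give the progression `a, b, a`.
  by_cases hp : p = 2
  · subst hp
    have h1 : 1 < S.card := by
      have h2 : n < 2 ^ n := Nat.lt_two_pow_self
      have h3 : (n : ℝ) < 2 ^ n := by exact_mod_cast h2
      have h4 : (1 : ℝ) < S.card := by
        by_contra! h
        push_cast at hS
        nlinarith
      exact_mod_cast h4
    obtain ⟨a, ha, b, hb, hab⟩ := one_lt_card.1 h1
    refine ⟨a, b - a, sub_ne_zero.2 hab.symm, ha, by simpa using hb, ?_⟩
    have : (2 : ℕ) • (b - a) = 0 := by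
      funext i
      simp only [Pi.smul_apply, nsmul_eq_mul, Pi.zero_apply]
      rw [show ((2 : ℕ) : ZMod 2) = 0 from ZMod.natCast_self 2, zero_mul]
    rwa [this, add_zero]
  · by_contra! hcon
    have hAP : APFree S := by
      intro m d h1 h2 h3
      by_contra hd
      exact hcon m d hd h1 h2 h3
    have := card_mul_le_of_APFree hp n (Fin n → ZMod p) (by simp) S hAP
    simp only [Fintype.card_pi, ZMod.card, prod_const, card_univ, Fintype.card_fin,
      Nat.cast_pow] at this
    linarith

end Meshulam

/-! ### Perturbing along a direction of invariance -/

section Perturbation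

variable {p : ℕ} [Fact p.Prime] {V : Type*} [AddCommGroup V] [Module (ZMod p) V] [Fintype V]

lemma sum_sum_add_smul (G : V → ℝ) (w : V) :
    ∑ m, ∑ s : ZMod p, G (m + s • w) = p * ∑ m, G m := by
  rw [sum_comm]
  have : ∀ s : ZMod p, ∑ m, G (m + s • w) = ∑ m, G m := fun s =>
    Equiv.sum_comp (Equiv.addRight (s • w)) G
  simp [this, ZMod.card]

lemma sum_sum_sum_sum_add_smul (G : V → V → ℝ) (w : V) :
    ∑ m, ∑ d, ∑ s : ZMod p, ∑ t : ZMod p, G (m + s • w) (d + t • w) =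
      p ^ 2 * ∑ m, ∑ d, G m d := by
  have h1 : ∀ m, ∑ d, ∑ s : ZMod p, ∑ t : ZMod p, G (m + s • w) (d + t • w) =
      ∑ s : ZMod p, p * ∑ d, G (m + s • w) d := by
    intro m
    rw [sum_comm]
    exact sum_congr rfl fun s _ => sum_sum_add_smul (G (m + s • w)) w
  simp_rw [h1]
  rw [sum_sum_add_smul (fun m => p * ∑ d, G m d) w, ← mul_sum]
  ring

/-- For odd `p` any two of `s, s + t, s + 2t` vary independently, so terms with one or two factors
`lam` vanish. -/
lemma sum_sum_prod_add_mul (hp : p ≠ 2) {lam : ZMod p → ℝ} (h0 : ∑ x, lam x = 0)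
    (a₀ a₁ a₂ b₀ b₁ b₂ : ℝ) :
    ∑ s, ∑ t, (a₀ + b₀ * lam s) * (a₁ + b₁ * lam (s + t)) * (a₂ + b₂ * lam (s + 2 • t)) =
      p ^ 2 * (a₀ * a₁ * a₂) + b₀ * b₁ * b₂ * (p ^ 2 * Lambda3 lam) := by
  have hp0 : (p : ℝ) ≠ 0 := by exact_mod_cast (Fact.out : p.Prime).ne_zero
  have e1 : ∀ s, ∑ t, lam (s + t) = 0 := fun s => by
    rw [← h0]; exact Equiv.sum_comp (Equiv.addLeft s) lam
  have e2 : ∀ s, ∑ t : ZMod p, lam (s + 2 • t) = 0 := fun s => by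
    rw [← e1 s, ← Equiv.sum_comp (Equiv.mulLeft₀ (2 : ZMod p) (two_ne_zero_zmod hp))
      fun t => lam (s + t)]
    simp
  have e3 : ∑ s, ∑ t : ZMod p, lam (s + t) * lam (s + 2 • t) = 0 := by
    rw [sum_comm]
    have : ∀ t : ZMod p, ∑ s, lam (s + t) * lam (s + 2 • t) = ∑ s, lam s * lam (s + t) := by
      intro t
      rw [← Equiv.sum_comp (Equiv.addRight t) fun s => lam s * lam (s + t)]
      refine sum_congr rfl fun s _ => ?_
      simp [two_mul, add_assoc]
    simp_rw [this]
    rw [sum_comm]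
    simp [← mul_sum, e1]
  have e4 : (p : ℝ) ^ 2 * Lambda3 lam = ∑ s, ∑ t, lam s * lam (s + t) * lam (s + 2 • t) := by
    rw [Lambda3, ZMod.card]
    field_simp
  rw [e4]
  have key : ∀ s t : ZMod p,
      (a₀ + b₀ * lam s) * (a₁ + b₁ * lam (s + t)) * (a₂ + b₂ * lam (s + 2 • t)) =
        a₀ * a₁ * a₂ + b₀ * b₁ * b₂ * (lam s * lam (s + t) * lam (s + 2 • t)) +
        (b₀ * a₁ * a₂ * lam s + (a₀ * a₂ * b₁ + b₀ * b₁ * a₂ * lam s) * lam (s + t)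
          + (a₀ * a₁ * b₂ + b₀ * b₂ * a₁ * lam s) * lam (s + 2 • t)
          + a₀ * b₁ * b₂ * (lam (s + t) * lam (s + 2 • t))) := by
    intro s t
    ring
  simp_rw [key, sum_add_distrib, ← mul_sum]
  have e5 : ∑ s : ZMod p, ∑ _t : ZMod p, lam s = 0 := by
    rw [sum_comm]
    simp [h0]
  have e6 : ∑ _s : ZMod p, ∑ _t : ZMod p, a₂ = p ^ 2 * a₂ := by
    simp [ZMod.card]
    ring
  simp_rw [e1, e2]
  rw [e3, e5, e6]
  simp only [mul_zero, sum_const_zero, add_zero]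
  ring

/-- Averaging over `m + s • w` and `d + t • w` freezes `F` and `B` while `l` runs over all of `ZMod
p`, reducing to `sum_sum_prod_add_mul`. -/
lemma Lambda3_add_mul (hp : p ≠ 2) {l : Dual (ZMod p) V} {w : V} (hl : l w = 1) {F B : V → ℝ}
    (hF : ∀ m, ∀ s : ZMod p, F (m + s • w) = F m) (hB : ∀ m, ∀ s : ZMod p, B (m + s • w) = B m)
    {lam : ZMod p → ℝ} (h0 : ∑ x, lam x = 0) :
    Lambda3 (fun m => F m + B m * lam (l m)) = Lambda3 F + Lambda3 B * Lambda3 lam := by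
  have hp0 : (p : ℝ) ≠ 0 := by exact_mod_cast (Fact.out : p.Prime).ne_zero
  have inner : ∀ m d : V, ∑ s : ZMod p, ∑ t : ZMod p,
      (F (m + s • w) + B (m + s • w) * lam (l (m + s • w))) *
      (F (m + s • w + (d + t • w)) +
        B (m + s • w + (d + t • w)) * lam (l (m + s • w + (d + t • w)))) *
      (F (m + s • w + 2 • (d + t • w)) +
        B (m + s • w + 2 • (d + t • w)) * lam (l (m + s • w + 2 • (d + t • w)))) =
      p ^ 2 * (F m * F (m + d) * F (m + 2 • d)) +
        B m * B (m + d) * B (m + 2 • d) * (p ^ 2 * Lambda3 lam) := by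
    intro m d
    rw [← sum_sum_prod_add_mul hp h0]
    symm
    rw [← Equiv.sum_comp (Equiv.addLeft (l m))]
    refine sum_congr rfl fun s _ => ?_
    rw [← Equiv.sum_comp (Equiv.addLeft (l d))]
    refine sum_congr rfl fun t _ => ?_
    have e1 : m + s • w + (d + t • w) = m + d + (s + t) • w := by module
    have e2 : m + s • w + 2 • (d + t • w) = m + 2 • d + (s + 2 • t) • w := by
      rw [add_smul, smul_assoc]; module
    rw [e1, e2, hF, hF, hF, hB, hB, hB]
    have f0 : l (m + s • w) = l m + s := by simp [hl]
    have f1 : l (m + d + (s + t) • w) = l m + s + (l d + t) := by simp [hl]; ring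
    have f2 : l (m + 2 • d + (s + 2 • t) • w) = l m + s + 2 • (l d + t) := by simp [hl]; ring
    rw [f0, f1, f2]
    rfl
  have h := sum_sum_sum_sum_add_smul (p := p) (fun m d : V => (F m + B m * lam (l m)) *
      (F (m + d) + B (m + d) * lam (l (m + d))) *
      (F (m + 2 • d) + B (m + 2 • d) * lam (l (m + 2 • d)))) w
  simp_rw [inner, sum_add_distrib, ← mul_sum, ← sum_mul] at h
  have h' : ∑ m, ∑ d, (F m + B m * lam (l m)) *
      (F (m + d) + B (m + d) * lam (l (m + d))) *
      (F (m + 2 • d) + B (m + 2 • d) * lam (l (m + 2 • d))) =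
      (∑ m, ∑ d, F m * F (m + d) * F (m + 2 • d)) +
        (∑ m, ∑ d, B m * B (m + d) * B (m + 2 • d)) * Lambda3 lam := by
    apply mul_left_cancel₀ (pow_ne_zero 2 hp0)
    rw [← h]
    ring
  simp only [Lambda3] at h' ⊢
  rw [h']
  ring

lemma mean_add_mul {l : Dual (ZMod p) V} {w : V} (hl : l w = 1) {F B : V → ℝ}
    (hB : ∀ m, ∀ s : ZMod p, B (m + s • w) = B m)
    {lam : ZMod p → ℝ} (h0 : ∑ x, lam x = 0) :
    mean (fun m => F m + B m * lam (l m)) = mean F := by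
  have hp0 : (p : ℝ) ≠ 0 := by exact_mod_cast (Fact.out : p.Prime).ne_zero
  have h := sum_sum_add_smul (p := p) (fun m => B m * lam (l m)) w
  have h1 : ∀ m, ∑ s : ZMod p, B (m + s • w) * lam (l (m + s • w)) = 0 := by
    intro m
    simp_rw [hB, ← mul_sum]
    have : ∑ s : ZMod p, lam (l (m + s • w)) = ∑ x, lam x := by
      rw [← Equiv.sum_comp (Equiv.addLeft (l m)) lam]
      refine sum_congr rfl fun s _ => ?_
      simp [hl]
    rw [this, h0, mul_zero]
  simp_rw [h1] at h
  have h2 : ∑ m, B m * lam (l m) = 0 := by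
    simpa [hp0] using h.symm
  rw [mean, sum_add_distrib, h2, add_zero, mean]

/-- The number of `j` among `1, -1, 2, -2` with `j + a = 0`, counted with multiplicity. -/
noncomputable def freqWeight (a : ZMod p) : ℝ :=
  (if 1 + a = 0 then 1 else 0) + (if -1 + a = 0 then 1 else 0) +
    (if 2 + a = 0 then 1 else 0) + (if -2 + a = 0 then 1 else 0)

lemma sum_stdAddChar_mul (a : ZMod p) :
    ∑ x : ZMod p, (ZMod.stdAddChar (a * x) : ℂ) = if a = 0 then (p : ℂ) else 0 := by
  split_ifs with h
  · simp [h, ZMod.card]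
  · exact sum_stdAddChar_comp_eq_zero (AddMonoidHom.mulLeft a) (a := 1) (by simpa using h)

/-- A bounded function on `ZMod p` of mean zero with a negative count of progressions. -/
lemma exists_Lambda3_le_neg (hp : p ≠ 2) : ∃ lam : ZMod p → ℝ, (∀ x, |lam x| ≤ 1) ∧
    ∑ x, lam x = 0 ∧ Lambda3 lam ≤ -(1 / 64) := by
  set e : ZMod p → ℂ := fun x => ZMod.stdAddChar x with he
  have hpC : (p : ℂ) ≠ 0 := by exact_mod_cast (Fact.out : p.Prime).ne_zero
  -- Here `lam x = -(cos(2πx/p) + cos(4πx/p))/2`. All its Fourier coefficients are real and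
  -- nonpositive, so no term of `Λ₃` is positive; frequencies 1 and 2 make the term at `l = 1`
  -- nonzero. `freqWeight` absorbs coincidences such as `1 = -2` when `p = 3`.
  set lam : ZMod p → ℝ := fun x => -((e x).re + (e (2 * x)).re) / 2 with hlam
  have hre : ∀ x, ((e x).re : ℂ) = (e x + e (-x)) / 2 := by
    intro x
    rw [Complex.re_eq_add_conj, he]
    simp [AddChar.map_neg_eq_conj]
  have hlamC : ∀ x, (lam x : ℂ) = -(1 / 4) * (e (1 * x) + e (-1 * x) + e (2 * x) + e (-2 * x)) := by
    intro x
    simp only [hlam]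
    push_cast
    rw [hre, hre, one_mul, neg_one_mul, neg_mul 2 x]
    ring
  have hsum : ∑ x, lam x = 0 := by
    apply Complex.ofReal_injective
    rw [Complex.ofReal_sum]
    simp_rw [hlamC, ← mul_sum, sum_add_distrib, he, sum_stdAddChar_mul]
    simp [two_ne_zero_zmod hp]
  have hhat : ∀ L : Dual (ZMod p) (ZMod p), hat lam L = ((-(1 / 4) * freqWeight (L 1) : ℝ) : ℂ) := by
    intro L
    have hL : ∀ x, L x = L 1 * x := by
      intro x
      have := L.map_smul x 1
      rw [smul_eq_mul, mul_one, smul_eq_mul] at this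
      rw [this, mul_comm]
    have h1 : ∀ x, (lam x : ℂ) * (ZMod.stdAddChar (L x) : ℂ) =
        -(1 / 4) * (e ((1 + L 1) * x) + e ((-1 + L 1) * x) + e ((2 + L 1) * x)
          + e ((-2 + L 1) * x)) := by
      intro x
      rw [hlamC, hL]
      simp only [add_mul _ _ x, he, AddChar.map_add_eq_mul]
      ring
    rw [hat]
    have hb : ∀ (c : Prop) [Decidable c],
        (if c then (p : ℂ) else 0) = p * ((if c then 1 else 0 : ℝ) : ℂ) := by
      intro c _
      split_ifs <;> simp
    simp_rw [h1, ← mul_sum, sum_add_distrib, he, sum_stdAddChar_mul, ZMod.card, freqWeight, hb]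
    push_cast
    field_simp
  have hΛ : Lambda3 lam = ∑ L : Dual (ZMod p) (ZMod p),
      -(1 / 64) * (freqWeight (L 1) ^ 2 * freqWeight (-2 * L 1)) := by
    apply Complex.ofReal_injective
    rw [Lambda3_eq_sum_hat (p := p), Complex.ofReal_sum]
    refine sum_congr rfl fun L _ => ?_
    rw [hhat, hhat, LinearMap.smul_apply, smul_eq_mul]
    push_cast
    ring
  have hw0 : ∀ a : ZMod p, 0 ≤ freqWeight a := by
    intro a
    unfold freqWeight
    positivity
  have hw1 : 1 ≤ freqWeight (1 : ZMod p) := by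
    unfold freqWeight
    rw [if_pos (by ring : (-1 + 1 : ZMod p) = 0)]
    have : (0 : ℝ) ≤ (if (1 + 1 : ZMod p) = 0 then 1 else 0) +
      (if (2 + 1 : ZMod p) = 0 then 1 else 0) + (if (-2 + 1 : ZMod p) = 0 then 1 else 0) := by
      positivity
    linarith
  have hw2 : 1 ≤ freqWeight (-2 : ZMod p) := by
    unfold freqWeight
    rw [if_pos (by ring : (2 + -2 : ZMod p) = 0)]
    have : (0 : ℝ) ≤ (if (1 + -2 : ZMod p) = 0 then 1 else 0) +
      (if (-1 + -2 : ZMod p) = 0 then 1 else 0) + (if (-2 + -2 : ZMod p) = 0 then 1 else 0) := by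
      positivity
    linarith
  refine ⟨lam, fun x => ?_, hsum, ?_⟩
  · have h1 : ∀ y, |(e y).re| ≤ 1 := fun y =>
      (Complex.abs_re_le_norm _).trans (AddChar.norm_apply _ _).le
    have a := abs_le.1 (h1 x)
    have b := abs_le.1 (h1 (2 * x))
    simp only [hlam]
    exact abs_le.2 ⟨by linarith, by linarith⟩
  · have h1 : freqWeight (1 : ZMod p) ^ 2 * freqWeight (-2 : ZMod p) ≤
        ∑ L : Dual (ZMod p) (ZMod p), freqWeight (L 1) ^ 2 * freqWeight (-2 * L 1) := by
      have := single_le_sum (s := univ)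
        (f := fun L : Dual (ZMod p) (ZMod p) => freqWeight (L 1) ^ 2 * freqWeight (-2 * L 1))
        (fun L _ => mul_nonneg (sq_nonneg _) (hw0 _)) (mem_univ LinearMap.id)
      simpa using this
    rw [hΛ, ← mul_sum]
    nlinarith [one_le_mul_of_one_le_of_one_le (one_le_pow₀ hw1 (n := 2)) hw2]

end Perturbation

/-! ### Varnavides averaging -/

section Varnavides

variable {p : ℕ} [Fact p.Prime] {V : Type*} [AddCommGroup V] [Module (ZMod p) V] [Fintype V]

/-- For `d ≠ 0` the vector `∑ i, d i • v i` is equidistributed as `v` varies. -/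
lemma card_mul_sum_linearCombination {k : ℕ} {d : Fin k → ZMod p} (hd : d ≠ 0) (H : V → ℝ) :
    (Fintype.card V : ℝ) * ∑ v : Fin k → V, H (Fintype.linearCombination (ZMod p) v d) =
      (Fintype.card V : ℝ) ^ k * ∑ y, H y := by
  classical
  obtain ⟨i, hi⟩ := Function.ne_iff.1 hd
  -- Moving the `i`-th vector by `(d i)⁻¹ • y` moves the combination by `y`.
  have shift : ∀ y : V, ∑ v : Fin k → V, H (Fintype.linearCombination (ZMod p) v d) =
      ∑ v : Fin k → V, H (Fintype.linearCombination (ZMod p) v d + y) := by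
    intro y
    rw [← Equiv.sum_comp (Equiv.addRight (Pi.single i ((d i)⁻¹ • y) : Fin k → V))]
    refine sum_congr rfl fun v _ => ?_
    congr 1
    simp only [Equiv.coe_addRight, Fintype.linearCombination_apply, Pi.add_apply, smul_add,
      sum_add_distrib]
    congr 1
    rw [sum_eq_single i]
    · rw [Pi.single_eq_same, smul_smul, mul_inv_cancel₀ hi, one_smul]
    · intro j _ hj
      rw [Pi.single_eq_of_ne hj, smul_zero]
    · simp
  calc (Fintype.card V : ℝ) * ∑ v : Fin k → V, H (Fintype.linearCombination (ZMod p) v d)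
      = ∑ _y : V, ∑ v : Fin k → V, H (Fintype.linearCombination (ZMod p) v d) := by simp
    _ = ∑ y : V, ∑ v : Fin k → V, H (Fintype.linearCombination (ZMod p) v d + y) :=
        sum_congr rfl fun y _ => shift y
    _ = ∑ _v : Fin k → V, ∑ y, H y := by
        rw [sum_comm]
        exact sum_congr rfl fun v _ =>
          Equiv.sum_comp (Equiv.addLeft (Fintype.linearCombination (ZMod p) v d)) H
    _ = _ := by simp

/-- Density of progressions in a dense set, from Meshulam's theorem in dimension `k` by averaging
over affine maps. -/
lemma density_sub_le_Lambda3 {c δ : ℝ} (hc : IsMeshulamConstant p c) {k : ℕ} (hk : 1 ≤ k)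
    (hδ : c / k ≤ δ) (T : Finset V) :
    (T.card : ℝ) / Fintype.card V - δ ≤ (p : ℝ) ^ (2 * k) * Lambda3 (ind T) := by
  classical
  have hN := card_pos_real (V := V)
  have hp0 : (0 : ℝ) < p := by exact_mod_cast (Fact.out : p.Prime).pos
  set N : ℝ := (Fintype.card V : ℝ) with hNdef
  set G : V → V → ℝ := fun m d => ind T m * ind T (m + d) * ind T (m + 2 • d) with hG
  have hG0 : ∀ m d, 0 ≤ G m d := by
    intro m d
    simp only [hG, mul_ind_ind_ind]
    split_ifs <;> norm_num
  set A : ℝ := ∑ m, ∑ d, G m d with hA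
  have hΛ : Lambda3 (ind T) = (N ^ 2)⁻¹ * A := rfl
  have hA0 : 0 ≤ A := sum_nonneg fun m _ => sum_nonneg fun d _ => hG0 m d
  set Λ : (Fin k → V) → (Fin k → ZMod p) →ₗ[ZMod p] V :=
    fun v => Fintype.linearCombination (ZMod p) v with hΛdef
  -- Pull `T` back along `x ↦ a + Λ v x`. If the preimage has density above `δ`, it contains one
  -- progression with `d ≠ 0`, and its size is at most `p ^ k`; otherwise the left side is
  -- nonpositive. `Λ v d` may vanish, which is harmless since `Λ₃` counts trivial progressions.
  have pointwise : ∀ (v : Fin k → V) (a : V),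
      ∑ x, ind T (a + Λ v x) - (p : ℝ) ^ k * δ ≤
        (p : ℝ) ^ k * ∑ m, ∑ d ∈ univ.erase 0, G (a + Λ v m) (Λ v d) := by
    intro v a
    set S : Finset (Fin k → ZMod p) := univ.filter fun x => a + Λ v x ∈ T with hS
    have hcard : ∑ x, ind T (a + Λ v x) = S.card := by
      simp [ind, hS]
    have hScard : (S.card : ℝ) ≤ (p : ℝ) ^ k := by
      have := card_le_univ S
      simp only [Fintype.card_pi, ZMod.card, prod_const, card_univ, Fintype.card_fin] at this
      exact_mod_cast this
    have hsum0 : ∀ m, 0 ≤ ∑ d ∈ univ.erase 0, G (a + Λ v m) (Λ v d) :=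
      fun m => sum_nonneg fun d _ => hG0 _ _
    have hpk : (0 : ℝ) < (p : ℝ) ^ k := by positivity
    have hδ0 : 0 ≤ δ := le_trans (div_nonneg hc.1.le (Nat.cast_nonneg k)) hδ
    rw [hcard]
    by_cases hle : (S.card : ℝ) ≤ (p : ℝ) ^ k * δ
    · have := mul_nonneg hpk.le (sum_nonneg fun m (_ : m ∈ univ) => hsum0 m)
      linarith
    · push Not at hle
      obtain ⟨m, d, hd, h1, h2, h3⟩ := hc.2 k hk S (by
        have : c * (p : ℝ) ^ k / k = (p : ℝ) ^ k * (c / k) := by ring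
        rw [this]
        exact (mul_le_mul_of_nonneg_left hδ hpk.le).trans hle.le)
      have hone : G (a + Λ v m) (Λ v d) = 1 := by
        simp only [hS, mem_filter, mem_univ, true_and, map_add, map_nsmul, ← add_assoc] at h1 h2 h3
        simp only [hG, mul_ind_ind_ind]
        rw [if_pos ⟨h1, h2, h3⟩]
      have hge : 1 ≤ ∑ m, ∑ d ∈ univ.erase 0, G (a + Λ v m) (Λ v d) := by
        rw [← hone]
        refine le_trans ?_ (single_le_sum (fun m _ => hsum0 m) (mem_univ m))
        exact single_le_sum (f := fun d => G (a + Λ v m) (Λ v d)) (fun d _ => hG0 _ _)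
          (mem_erase.2 ⟨hd, mem_univ d⟩)
      nlinarith [mul_nonneg hpk.le hδ0]
  have summed := sum_le_sum fun v (_ : v ∈ univ) => sum_le_sum fun a (_ : a ∈ univ) => pointwise v a
  have hL : ∑ v : Fin k → V, ∑ a, (∑ x, ind T (a + Λ v x) - (p : ℝ) ^ k * δ) =
      (p : ℝ) ^ k * N ^ k * (T.card - N * δ) := by
    have h1 : ∀ v : Fin k → V, ∑ a, ∑ x, ind T (a + Λ v x) = (p : ℝ) ^ k * T.card := by
      intro v
      rw [sum_comm]
      have : ∀ x, ∑ a, ind T (a + Λ v x) = T.card := by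
        intro x
        exact (Equiv.sum_comp (Equiv.addRight (Λ v x)) (ind T)).trans (by simp [ind])
      simp [this, ZMod.card]
    simp_rw [sum_sub_distrib, h1]
    simp [hNdef]
    ring
  have hR : N * ∑ v : Fin k → V, ∑ a, (p : ℝ) ^ k *
      ∑ m, ∑ d ∈ univ.erase 0, G (a + Λ v m) (Λ v d) ≤ (p : ℝ) ^ k * N ^ k * (p ^ (2 * k) * A) := by
    -- For fixed `m` and `d ≠ 0` the pair `(a + Λ v m, Λ v d)` is equidistributed in `V × V`, so
    -- each of the at most `p ^ (2k)` pairs contributes equally.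
    have h1 : ∀ m : Fin k → ZMod p, ∀ d ∈ univ.erase (0 : Fin k → ZMod p),
        N * ∑ v : Fin k → V, ∑ a, G (a + Λ v m) (Λ v d) = N ^ k * A := by
      intro m d hd
      have : ∀ v : Fin k → V, ∑ a, G (a + Λ v m) (Λ v d) = ∑ a, G a (Λ v d) := fun v =>
        Equiv.sum_comp (Equiv.addRight (Λ v m)) fun a => G a (Λ v d)
      simp_rw [this]
      rw [card_mul_sum_linearCombination (ne_of_mem_erase hd) fun y => ∑ a, G a y, hA, sum_comm]
    have h2 : ∑ v : Fin k → V, ∑ a, (p : ℝ) ^ k *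
        ∑ m, ∑ d ∈ univ.erase 0, G (a + Λ v m) (Λ v d) =
        (p : ℝ) ^ k * ∑ m : Fin k → ZMod p, ∑ d ∈ univ.erase 0,
          ∑ v : Fin k → V, ∑ a, G (a + Λ v m) (Λ v d) := by
      simp_rw [← mul_sum]
      congr 1
      rw [← sum_product' univ univ fun v a => ∑ m, ∑ d ∈ univ.erase 0, G (a + Λ v m) (Λ v d),
        sum_comm]
      refine sum_congr rfl fun m _ => ?_
      rw [sum_comm]
      refine sum_congr rfl fun d _ => ?_
      rw [sum_product]
    rw [h2, mul_left_comm, mul_assoc]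
    refine mul_le_mul_of_nonneg_left ?_ (by positivity)
    calc N * ∑ m : Fin k → ZMod p, ∑ d ∈ univ.erase 0, ∑ v : Fin k → V, ∑ a, G (a + Λ v m) (Λ v d)
        = ∑ m : Fin k → ZMod p, ∑ d ∈ univ.erase (0 : Fin k → ZMod p), N ^ k * A := by
          rw [mul_sum]
          refine sum_congr rfl fun m _ => ?_
          rw [mul_sum]
          exact sum_congr rfl fun d hd => h1 m d hd
      _ ≤ ∑ m : Fin k → ZMod p, ∑ d : Fin k → ZMod p, N ^ k * A := by
          refine sum_le_sum fun m _ => ?_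
          exact sum_le_sum_of_subset_of_nonneg (erase_subset _ _) fun _ _ _ =>
            mul_nonneg (pow_nonneg hN.le _) hA0
      _ = N ^ k * (p ^ (2 * k) * A) := by
          simp [ZMod.card]
          ring
  rw [hL] at summed
  have h1 := (mul_le_mul_of_nonneg_left summed hN.le).trans hR
  have h2 : N * (T.card - N * δ) ≤ p ^ (2 * k) * A := by
    have hpos : 0 < (p : ℝ) ^ k * N ^ k := by positivity
    refine le_of_mul_le_mul_left ?_ hpos
    linarith
  have h3 : (T.card : ℝ) / N - δ = (N ^ 2)⁻¹ * (N * (T.card - N * δ)) := by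
    field_simp
  rw [hΛ, h3]
  have := mul_le_mul_of_nonneg_left h2 (inv_nonneg.2 (sq_nonneg N))
  linarith

end Varnavides

/-! ### Coset averaging as conditional expectation -/

section CosetMean

variable {p : ℕ} [Fact p.Prime] {V : Type*} [AddCommGroup V] [Module (ZMod p) V] [Fintype V]

lemma cosetMean_add_of_mem (W : Submodule (ZMod p) V) (f : V → ℝ) (m : V) {w : V} (hw : w ∈ W) :
    cosetMean W f (m + w) = cosetMean W f m := by
  classical
  rw [cosetMean, cosetMean]
  congr 1
  rw [← Equiv.sum_comp (Equiv.addLeft (⟨w, hw⟩ : W)) fun v : W => f (m + v)]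
  refine sum_congr rfl fun v _ => ?_
  simp [add_assoc]

lemma sum_cosetMean_mul (W : Submodule (ZMod p) V) (f : V → ℝ) {H : V → ℝ}
    (hH : ∀ m, ∀ w ∈ W, H (m + w) = H m) :
    ∑ m, cosetMean W f m * H m = ∑ m, f m * H m := by
  classical
  have h1 : ∀ m, cosetMean W f m * H m =
      (Fintype.card W : ℝ)⁻¹ * ∑ w : W, f (m + w) * H (m + w) := by
    intro m
    rw [cosetMean, mul_assoc, sum_mul]
    congr 1
    exact sum_congr rfl fun w _ => by rw [hH m w w.2]
  simp_rw [h1]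
  rw [← mul_sum, sum_comm]
  have h2 : ∀ w : W, ∑ m, f (m + w) * H (m + w) = ∑ m, f m * H m := fun w =>
    Equiv.sum_comp (Equiv.addRight (w : V)) fun m => f m * H m
  simp [h2]

lemma mean_cosetMean (W : Submodule (ZMod p) V) (f : V → ℝ) :
    mean (cosetMean W f) = mean f := by
  have := sum_cosetMean_mul W f (H := fun _ => 1) (by simp)
  simp only [mul_one] at this
  rw [mean, this, mean]

lemma mean_mono {V : Type*} [Fintype V] {g h : V → ℝ} (hgh : ∀ m, g m ≤ h m) :
    mean g ≤ mean h :=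
  mul_le_mul_of_nonneg_left (sum_le_sum fun m _ => hgh m) (by positivity)

/-- For `a, b ∈ [0, 1]`, `|a - b| ≤ a(1 - b) + b(1 - a)`; then `f` may be replaced by `f_W` when
averaged against `W`-invariant functions. -/
lemma mean_abs_sub_cosetMean_le (W : Submodule (ZMod p) V) {f : V → ℝ}
    (hf : ∀ m, f m ∈ Set.Icc (0 : ℝ) 1) :
    mean (fun m => |f m - cosetMean W f m|) ≤
      mean (fun m => 2 * (cosetMean W f m * (1 - cosetMean W f m))) := by
  have h1 : ∀ m, |f m - cosetMean W f m| ≤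
      f m + cosetMean W f m - 2 * (f m * cosetMean W f m) := by
    intro m
    obtain ⟨a0, a1⟩ := hf m
    obtain ⟨b0, b1⟩ := cosetMean_mem_Icc W hf m
    refine abs_le.2 ⟨?_, ?_⟩ <;>
      nlinarith [mul_nonneg a0 (sub_nonneg.2 b1), mul_nonneg b0 (sub_nonneg.2 a1)]
  refine (mean_mono h1).trans (le_of_eq ?_)
  have h2 := sum_cosetMean_mul W f (H := fun _ => 1) (by simp)
  have h3 := sum_cosetMean_mul W f (H := cosetMean W f) fun m w hw => cosetMean_add_of_mem W f m hw
  simp only [mul_one] at h2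
  rw [mean, mean]
  congr 1
  simp_rw [mul_sub, mul_one, sum_sub_distrib, sum_add_distrib, ← mul_sum]
  rw [h3, h2]
  ring

end CosetMean

/-! ### Scaling of `Λ₃` and size of `Δ` -/

section Bounds

variable {p : ℕ} [Fact p.Prime] {V : Type*} [AddCommGroup V] [Module (ZMod p) V] [Fintype V]

lemma Lambda3_const_mul (a : ℝ) (B : V → ℝ) :
    Lambda3 (fun m => a * B m) = a ^ 3 * Lambda3 B := by
  simp_rw [Lambda3, mul_sum]
  refine sum_congr rfl fun m _ => sum_congr rfl fun d _ => ?_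
  ring

lemma exp_factor_le_one {c ε : ℝ} (hc : 0 < c) (hε : 0 < ε) (k : ℝ) (hk : 0 ≤ k) :
    Real.exp (-k * ε⁻¹ * c * Real.log (p : ℝ)) ≤ 1 := by
  rw [Real.exp_le_one_iff]
  have h1 : 0 ≤ Real.log (p : ℝ) :=
    Real.log_nonneg (by exact_mod_cast (Fact.out : p.Prime).one_le)
  have : 0 ≤ k * ε⁻¹ * c * Real.log (p : ℝ) := by positivity
  linarith

lemma Delta_pos (c : ℝ) {ε : ℝ} (hε : 0 < ε) : 0 < Delta p c ε := by
  have hp0 : (0 : ℝ) < p := by exact_mod_cast (Fact.out : p.Prime).pos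
  unfold Delta
  positivity

end Bounds

lemma mean_const {V : Type*} [AddCommGroup V] [Fintype V] (a : ℝ) : mean (fun _ : V => a) = a := by
  have := card_ne_zero_real (V := V)
  simp [mean]

lemma lt_two_mul_mean (p : ℕ) [Fact p.Prime] {V : Type*} [AddCommGroup V] [Module (ZMod p) V]
    [Fintype V] {ε : ℝ} {f : V → ℝ} (hf : ∀ m, f m ∈ Set.Icc (0 : ℝ) 1)
    (h : ε < mean (fun m => |f m - mean f|)) : ε < 2 * (mean f * (1 - mean f)) := by
  have h1 := mean_abs_sub_cosetMean_le (⊤ : Submodule (ZMod p) V) hf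
  simp_rw [cosetMean_top, mean_const] at h1
  exact h.trans_le h1

lemma mean_mem_Icc {V : Type*} [AddCommGroup V] [Fintype V] {f : V → ℝ}
    (hf : ∀ m, f m ∈ Set.Icc (0 : ℝ) 1) : mean f ∈ Set.Icc (0 : ℝ) 1 := by
  refine ⟨?_, mean_le_of_forall_le fun m => (hf m).2⟩
  have := sum_nonneg (s := univ) fun m _ => (hf m).1
  unfold mean
  positivity

/-! ### Characteristic two, and the construction for odd `p` -/

section Main

variable {p : ℕ} [Fact p.Prime] {V : Type*} [AddCommGroup V] [Module (ZMod p) V] [Fintype V]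

lemma Lambda3_of_two_nsmul_eq_zero (h2 : ∀ d : V, 2 • d = 0) (f : V → ℝ) :
    Lambda3 f = mean (fun m => f m ^ 2) * mean f := by
  have h : ∀ m, ∑ d, f m * f (m + d) * f (m + 2 • d) = f m ^ 2 * ∑ d, f d := by
    intro m
    rw [← Equiv.sum_comp (Equiv.addLeft m) f, mul_sum]
    refine sum_congr rfl fun d _ => ?_
    rw [h2, add_zero, Equiv.coe_addLeft]
    ring
  simp_rw [Lambda3, h, ← sum_mul, mean]
  rw [← inv_pow]
  ring

/-- In characteristic two the constant function has few progressions. -/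
lemma Lambda3_const_mean_lt (h2 : ∀ d : V, 2 • d = 0) {ε : ℝ} (hε : 0 < ε) {f : V → ℝ}
    (hμ : ε < 2 * mean f) (h : ε < mean (fun m => |f m - mean f|)) :
    Lambda3 (fun _ : V => mean f) < Lambda3 f - ε ^ 3 / 2 := by
  rw [Lambda3_const, Lambda3_of_two_nsmul_eq_zero h2]
  set μ := mean f with hμdef
  -- The variance exceeds the squared mean deviation, and `Λ₃(f) - μ³` is `μ` times the variance.
  have hvar : ε ^ 2 < mean (fun m => f m ^ 2) - μ ^ 2 := by
    have h3 : ∀ m, 2 * ε * |f m - μ| - ε ^ 2 ≤ f m ^ 2 - 2 * μ * f m + μ ^ 2 := by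
      intro m
      nlinarith [sq_nonneg (|f m - μ| - ε), sq_abs (f m - μ)]
    have h4 := mean_mono h3
    have h5 : mean (fun m => 2 * ε * |f m - μ| - ε ^ 2) =
        2 * ε * mean (fun m => |f m - μ|) - mean (fun _ : V => ε ^ 2) := by
      simp_rw [mean, sum_sub_distrib, ← mul_sum]
      ring
    have h6 : mean (fun m => f m ^ 2 - 2 * μ * f m + μ ^ 2) =
        mean (fun m => f m ^ 2) - 2 * μ * μ + mean (fun _ : V => μ ^ 2) := by
      nth_rewrite 4 [hμdef]
      simp_rw [mean, sum_add_distrib, sum_sub_distrib, ← mul_sum]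
      ring
    rw [h5, h6, mean_const, mean_const] at h4
    nlinarith
  nlinarith

/-- The set of points where `F` stays away from `0` and `1` is dense if `F (1 - F)` is large on
average. -/
lemma lt_density_of_lt_mean {ε : ℝ} (hε : 0 < ε) {F : V → ℝ} (hF : ∀ m, F m ∈ Set.Icc (0 : ℝ) 1)
    (h : ε < mean (fun m => 2 * (F m * (1 - F m))))
    [DecidablePred fun m => F m ∈ Set.Icc (ε / 4) (1 - ε / 4)] :
    ε < ((univ.filter fun m => F m ∈ Set.Icc (ε / 4) (1 - ε / 4)).card : ℝ) / Fintype.card V := by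
  set T := univ.filter fun m => F m ∈ Set.Icc (ε / 4) (1 - ε / 4) with hT
  -- `2F(1 - F)` is at most `1/2` everywhere and at most `ε/2` off `T`.
  have h1 : ∀ m, 2 * (F m * (1 - F m)) ≤ 1 / 2 * ind T m + ε / 2 := by
    intro m
    obtain ⟨a0, a1⟩ := hF m
    by_cases hm : m ∈ T
    · simp only [ind, if_pos hm]
      nlinarith [sq_nonneg (2 * F m - 1)]
    · simp only [ind, if_neg hm]
      have : F m < ε / 4 ∨ 1 - ε / 4 < F m := by
        by_contra! hcon
        exact hm (mem_filter.2 ⟨mem_univ _, hcon⟩)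
      rcases this with h | h <;> nlinarith
  have h2 := h.trans_le (mean_mono h1)
  have h3 : mean (fun m => 1 / 2 * ind T m + ε / 2) =
      1 / 2 * mean (ind T) + mean (fun _ : V => ε / 2) := by
    simp_rw [mean, sum_add_distrib, ← mul_sum]
    ring
  rw [h3, mean_const, mean_ind] at h2
  linarith

/-- `4096 = 4³ · 64` combines the amplitude `ε/4` with `Λ₃(λ) ≤ -1/64`. Rounding up in `k = ⌈2c/ε⌉`
costs `p²`, as `p ^ (2k) ≤ p² exp(4 ε⁻¹ c log p)`; the 16 in `Δ` is more than enough. -/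
lemma Delta_lt_of_density {c ε L : ℝ} (hc : 0 < c) (hε : 0 < ε) (hε2 : ε < 1 / 2)
    (hL : ε / 2 < (p : ℝ) ^ (2 * ⌈2 * c / ε⌉₊) * L) :
    2 * Delta p c ε < ε ^ 3 / 4096 * L := by
  have hp0 : (0 : ℝ) < p := by exact_mod_cast (Fact.out : p.Prime).pos
  have hlog : 0 ≤ Real.log (p : ℝ) :=
    Real.log_nonneg (by exact_mod_cast (Fact.out : p.Prime).one_le)
  set Y := Real.exp (-4 * ε⁻¹ * c * Real.log (p : ℝ)) with hY
  set X := Real.exp (-16 * ε⁻¹ * c * Real.log (p : ℝ)) with hX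
  have hXpos : 0 < X := Real.exp_pos _
  have hYpos : 0 < Y := Real.exp_pos _
  have hXY : X ≤ Y := by
    rw [hX, hY, Real.exp_le_exp]
    have : 0 ≤ ε⁻¹ * c * Real.log (p : ℝ) := by positivity
    linarith
  have hL0 : 0 < L := by
    by_contra! h
    nlinarith [mul_nonneg (pow_pos hp0 (2 * ⌈2 * c / ε⌉₊)).le (neg_nonneg.2 h)]
  have hpow : (p : ℝ) ^ (2 * ⌈2 * c / ε⌉₊) * Y ≤ (p : ℝ) ^ 2 := by
    have hk : (⌈2 * c / ε⌉₊ : ℝ) < 2 * c / ε + 1 := Nat.ceil_lt_add_one (by positivity)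
    rw [hY, ← Real.exp_log hp0, ← Real.exp_nat_mul, ← Real.exp_nat_mul, ← Real.exp_add,
      Real.exp_le_exp, Real.log_exp]
    push_cast
    have : 2 * (⌈2 * c / ε⌉₊ : ℝ) * Real.log p ≤ 2 * (2 * c / ε + 1) * Real.log p := by
      gcongr
    have e : 2 * (2 * c / ε + 1) * Real.log p + -4 * ε⁻¹ * c * Real.log p = 2 * Real.log p := by
      field_simp
      ring
    linarith
  have h1 : ε / 2 * Y < (p : ℝ) ^ 2 * L := by
    calc ε / 2 * Y < (p : ℝ) ^ (2 * ⌈2 * c / ε⌉₊) * L * Y := by gcongr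
      _ = (p : ℝ) ^ (2 * ⌈2 * c / ε⌉₊) * Y * L := by ring
      _ ≤ _ := by gcongr
  have h2 : ε / 2 * X < (p : ℝ) ^ 2 * L := lt_of_le_of_lt (by gcongr) h1
  have e : 2 * Delta p c ε = ε ^ 3 / 4096 * (ε ^ 3 * X / (p : ℝ) ^ 2) := by
    rw [Delta, ← hX]
    field_simp
    norm_num
  rw [e]
  refine mul_lt_mul_of_pos_left ?_ (by positivity)
  rw [div_lt_iff₀ (by positivity)]
  have h3 : ε ^ 3 ≤ ε / 2 := by nlinarith [mul_pos hε hε]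
  calc ε ^ 3 * X ≤ ε / 2 * X := by gcongr
    _ < _ := by linarith

lemma Delta_lt_cube {c ε : ℝ} (hc : 0 < c) (hε : 0 < ε) (hε2 : ε < 1 / 2) :
    Delta p c ε < ε ^ 3 / 2 := by
  have hp1 : (1 : ℝ) ≤ p := by exact_mod_cast (Fact.out : p.Prime).one_le
  have h1 := exp_factor_le_one (p := p) hc hε 16 (by norm_num)
  have h2 : ε ^ 6 / (2 ^ 13 * (p : ℝ) ^ 2) ≤ ε ^ 6 := by
    refine div_le_self (by positivity) ?_
    nlinarith
  calc Delta p c ε ≤ ε ^ 6 / (2 ^ 13 * (p : ℝ) ^ 2) * 1 := by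
        unfold Delta
        exact mul_le_mul_of_nonneg_left h1 (by positivity)
    _ ≤ ε ^ 3 * ε ^ 3 := by linarith
    _ < ε ^ 3 * (1 / 2) := by
        refine mul_lt_mul_of_pos_left ?_ (by positivity)
        calc ε ^ 3 < (1 / 2) ^ 3 := by gcongr
          _ < 1 / 2 := by norm_num
    _ = _ := by ring

/-- A function far from its average over a subspace `W`, with about as many progressions as that
average, can be modified to have fewer progressions. -/
lemma exists_Lambda3_lt_of_cosetMean (hp : p ≠ 2) {c ε : ℝ} (hc : IsMeshulamConstant p c)
    (hε : 0 < ε) (hε2 : ε < 1 / 2) {f : V → ℝ} (hf : ∀ m, f m ∈ Set.Icc (0 : ℝ) 1)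
    (W : Submodule (ZMod p) V)
    (hW : Lambda3 (cosetMean W f) ≤ Lambda3 f + Delta p c ε)
    (hdist : ε < mean (fun m => |f m - cosetMean W f m|)) :
    ∃ g : V → ℝ, (∀ m, g m ∈ Set.Icc (0 : ℝ) 1) ∧ mean g = mean f ∧
      Lambda3 g < Lambda3 f - Delta p c ε := by
  classical
  set F := cosetMean W f with hF
  have hF01 : ∀ m, F m ∈ Set.Icc (0 : ℝ) 1 := cosetMean_mem_Icc W hf
  set T := univ.filter fun m => F m ∈ Set.Icc (ε / 4) (1 - ε / 4) with hT
  have hdens : ε < (T.card : ℝ) / Fintype.card V :=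
    lt_density_of_lt_mean hε hF01 (hdist.trans_le (mean_abs_sub_cosetMean_le W hf))
  -- If `W` were zero, `f_W` would equal `f`.
  obtain ⟨w, hw, hw0⟩ : ∃ w ∈ W, w ≠ 0 := by
    by_contra! hcon
    have hFf : ∀ m, F m = f m := by
      intro m
      have h1 : ∀ w : W, f (m + w) = f m := fun w => by rw [hcon w w.2, add_zero]
      have h2 : (Fintype.card W : ℝ) ≠ 0 := by exact_mod_cast Fintype.card_ne_zero
      rw [hF, cosetMean]
      simp_rw [h1]
      simp [h2]
    simp_rw [hFf, sub_self, abs_zero, mean_const] at hdist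
    exact absurd hdist (not_lt.2 hε.le)
  obtain ⟨l₀, hl₀⟩ := exists_dual_apply_ne_zero (p := p) hw0
  set l : Dual (ZMod p) V := (l₀ w)⁻¹ • l₀ with hl
  have hlw : l w = 1 := by
    rw [hl, LinearMap.smul_apply, smul_eq_mul, inv_mul_cancel₀ hl₀]
  have hFinv : ∀ m, ∀ s : ZMod p, F (m + s • w) = F m := fun m s =>
    cosetMean_add_of_mem W f m (W.smul_mem s hw)
  have hBinv : ∀ m, ∀ s : ZMod p, ε / 4 * ind T (m + s • w) = ε / 4 * ind T m := by
    intro m s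
    simp only [ind, hT, mem_filter, mem_univ, true_and, hFinv]
  obtain ⟨lam, hlam1, hlam0, hlam3⟩ := exists_Lambda3_le_neg (p := p) hp
  -- On `T` there is room `ε/4` on both sides of `F`, and `|lam| ≤ 1`.
  refine ⟨fun m => F m + ε / 4 * ind T m * lam (l m), fun m => ?_, ?_, ?_⟩
  · obtain ⟨a, b⟩ := abs_le.1 (hlam1 (l m))
    by_cases hm : m ∈ T
    · obtain ⟨t0, t1⟩ := (mem_filter.1 hm).2
      simp only [ind, if_pos hm, mul_one]
      constructor <;> nlinarith
    · simpa [ind, hm] using hF01 m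
  · rw [mean_add_mul (F := F) hlw hBinv hlam0, mean_cosetMean]
  · rw [Lambda3_add_mul hp hlw hFinv hBinv hlam0, Lambda3_const_mul]
    -- This dimension gives Meshulam threshold `c/k ≤ ε/2`, half the density guaranteed for `T`.
    set k := ⌈2 * c / ε⌉₊ with hk
    have hc0 := hc.1
    have hk1 : 1 ≤ k := Nat.ceil_pos.2 (by positivity)
    have hk0 : (0 : ℝ) < k := by exact_mod_cast hk1
    have hck : c / k ≤ ε / 2 := by
      have := Nat.le_ceil (2 * c / ε)
      rw [← hk, div_le_iff₀ hε] at this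
      rw [div_le_iff₀ hk0]
      linarith
    have hV := density_sub_le_Lambda3 hc hk1 hck T
    have hΛ := Delta_lt_of_density (p := p) (L := Lambda3 (ind T)) hc0 hε hε2 (by linarith)
    have hpos : 0 < ε ^ 3 * Lambda3 (ind T) := by
      have := Delta_pos (p := p) c hε
      linarith
    have : (ε / 4) ^ 3 * Lambda3 (ind T) * Lambda3 lam ≤
        (ε / 4) ^ 3 * Lambda3 (ind T) * -(1 / 64) :=
      mul_le_mul_of_nonneg_left hlam3 (by linarith)
    linarith

end Main

end ThreeAP

theorem theorem3 (p : ℕ) [Fact p.Prime] :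
    (∃ c : ℝ, ThreeAP.IsMeshulamConstant p c) ∧
    ∀ c : ℝ, ThreeAP.IsMeshulamConstant p c →
      ∀ (V : Type*) [AddCommGroup V] [Module (ZMod p) V] [Fintype V] (ε : ℝ), 0 < ε →
        ∀ f : V → ℝ, (∀ m, f m ∈ Set.Icc (0 : ℝ) 1) →
          (∀ W : Submodule (ZMod p) V,
            (Module.finrank (ZMod p) (V ⧸ W) : ℝ) ≤ ThreeAP.Delta p c ε ^ (-2 : ℤ) →
              ε < ThreeAP.mean (fun m => |f m - ThreeAP.cosetMean W f m|)) →
          ∃ g : V → ℝ, (∀ m, g m ∈ Set.Icc (0 : ℝ) 1) ∧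
            ThreeAP.mean g = ThreeAP.mean f ∧
            ThreeAP.Lambda3 g < ThreeAP.Lambda3 f - ThreeAP.Delta p c ε := by
  refine ⟨⟨9, ThreeAP.isMeshulamConstant_nine⟩, fun c hc V _ _ _ ε hε f hf hfar => ?_⟩
  have hΔ := ThreeAP.Delta_pos (p := p) c hε
  have htop : ε < ThreeAP.mean (fun m => |f m - ThreeAP.mean f|) := by
    -- `W = ⊤` has codimension 0; it yields `ε < 2μ(1 - μ) ≤ 1/2`.
    have h := hfar ⊤ (by
      rw [Module.finrank_zero_of_subsingleton, Nat.cast_zero]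
      positivity)
    simpa only [ThreeAP.cosetMean_top] using h
  have hμ := ThreeAP.lt_two_mul_mean p hf htop
  have hμ01 := ThreeAP.mean_mem_Icc hf
  have hε2 : ε < 1 / 2 := by nlinarith [sq_nonneg (2 * ThreeAP.mean f - 1)]
  by_cases hp : p = 2
  · subst hp
    refine ⟨fun _ => ThreeAP.mean f, fun _ => hμ01, ThreeAP.mean_const _, ?_⟩
    have h2 : ∀ d : V, 2 • d = 0 := fun d => by
      rw [← Nat.cast_smul_eq_nsmul (ZMod 2), ZMod.natCast_self, zero_smul]
    have h1 := ThreeAP.Lambda3_const_mean_lt h2 hε (by nlinarith [hμ01.1]) htop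
    have h3 := ThreeAP.Delta_lt_cube (p := 2) hc.1 hε hε2
    linarith
  · obtain ⟨W, hW, hΛ⟩ := ThreeAP.exists_submodule_Lambda3_cosetMean_le hp hf hΔ
    exact ThreeAP.exists_Lambda3_lt_of_cosetMean hp hc hε hε2 hf W hΛ (hfar W hW)
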